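/- **Proposition 3.1 (Free Energy Implications).** Let $(x_i,y_i)_{i=1}^N$, $N\ge 1$, be samples in $\mathcal X\times\mathcal Y$, where $\mathcal X$ carries a (pseudo)metric $d$. Let $f_\theta:\mathcal X\to\mathcal Y$ ($\theta\in\Theta$) be predictors and $\ell$ a real-valued loss, and write $\ell_i=\ell_i(\theta)=\ell(f_\theta(x_i),y_i)$ and $\vec\ell=(\ell_1,\dots,\ell_N)$. Let $\rho>0$, $\alpha,\beta\in\mathbb R$, $L\ge 0$, $s>0$. Let $\Delta_N$ be the probability simplex, $\Delta_N^\circ$ its relative interior, $\hat p=(\frac1N,\dots,\frac1N)$, and $H[q]=-\sum_i q_i\log q_i$ with $0\log 0=0$. Use the following notation. * $D_{\rm KL}(q)=\sum_i q_i\log(Nq_i)$ and $D_{\chi^2}(q)=\frac1N\sum_i(Nq_i-1)^2$. * For a reproducing kernel Hilbert space $\mathcal H$ of real functions on $\mathcal X\times\mathcal Y$ with kernel $k$, let $z_i=(x_i,y_i)$, $G_{ij}=k(z_i,z_j)$ and $\mathrm{MMD}(q)=\sup_{\|h\|_{\mathcal H}\le1}\sum_i(q_i-\frac1N)h(z_i)$.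 * $q$ is *Hölder* if $|Nq_i-Nq_j|\le L\,d(x_i,x_j)^s$ for all $i,j$. * For an undirected weighted graph on $\{1,\dots,N\}$ with symmetric weights $w_{ij}$, positive on edges, let $\sum_{(i,j)\in E}$ run over ordered pairs of adjacent nodes. Let $\xi_{ij}$ be a measurable interpolation of the densities: it depends on $p_i,p_j$ and possibly on the velocity $v_{ij}$, satisfies $\min(p_i,p_j)\le\xi_{ij}\le\max(p_i,p_j)$, and satisfies $\xi_{ij}=\xi_{ji}$ when $v_{ij}=-v_{ji}\neq 0$ (for example the upwind interpolation). For $q\in\Delta_N^\circ$, $$\mathcal{GW}^2(\hat p,q)=\inf\int_0^1\tfrac12\sum_{(i,j)\in E}\xi_{ij}v_{ij}^2\,dt,$$ where the infimum is over differentiable curves $p:[0,1]\to\Delta_N^\circ$ from $\hat p$ to $q$ and measurable velocities with $v_{ij}=-v_{ji}$ on edges and $\dot p_i=\sum_{j:(i,j)\in E}\sqrt{w_{ij}}\,v_{ij}\,\xi_{ij}$; the infimum of the empty set is $+\infty$. The geometric Wasserstein set is $B_{\mathcal{GW}}=\{q\in\Delta_N^\circ:\mathcal{GW}^2(\hat p,q)\le\rho\}$.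 A free-energy model consists of an interaction matrix $K$, a potential $V$, a temperature $T$, a feasible set $\mathscr P\subseteq\mathbb R^N$ and a number $\rho'$, where $K$ and $V$ may depend on $(\theta,\lambda)$ and $T$ on $\lambda$. Its free energy is $$\mathcal E(q,\theta,\lambda)=q^\top Kq+q^\top V-T\,H[q].$$ A problem $\min_\theta\sup_{q\in U}R(\theta,q)$ is said to be *equivalent* to $$\min_{\theta\in\Theta,\ \lambda\ge0}\ \max_{q\in\mathscr P}\{\lambda\rho'-\mathcal E(q,\theta,\lambda)\}$$ if the following hold. For every $\theta$ the number $\sup_{q\in U}R(\theta,q)$ is finite and equals $\min_{\lambda\ge0}\sup_{q\in\mathscr P}\{\lambda\rho'-\mathcal E(q,\theta,\lambda)\}$, the minimum over $\lambda$ being attained. The infima of the two problems (over $\theta$, and over $(\theta,\lambda)$) agree. A parameter $\theta$ is optimal in the first problem iff $(\theta,\lambda)$ is optimal in the second for some $\lambda\ge0$. Then each of the following DRO problems is equivalent to the free-energy problem with the data listed. | Method | $R(\theta,q)$ | $U$ | $K$ | $V$ | $T$ | $\mathscr P$ | $\rho'$ | |---|---|---|---|---|---|---|---| | KL-DRO |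 $q^\top\vec\ell$ | $\{q\in\Delta_N:D_{\rm KL}(q)\le\rho\}$ | $0$ | $-\vec\ell$ | $\lambda$ | $\Delta_N$ | $\rho-\log N$ | | $\chi^2$-DRO | $q^\top\vec\ell$ | $\{q\in\Delta_N:D_{\chi^2}(q)\le\rho\}$ | $\lambda I$ | $-\vec\ell$ | $0$ | $\Delta_N$ | $(1+\rho)/N$ | | MMD-DRO | $q^\top\vec\ell$ | $\{q\in\Delta_N:\mathrm{MMD}(q)^2\le\rho\}$ | $\lambda G$ | $-\vec\ell-\frac{2\lambda}{N}G^\top\mathbf 1$ | $0$ | $\Delta_N$ | $\rho-\frac1{N^2}\mathbf 1^\top G\mathbf 1$ | | marginal $\chi^2$-DRO (for $\ell\ge0$, with $\lambda=\eta$) | $q^\top\vec\ell$ | $\{q\in\Delta_N:D_{\chi^2}(q)\le\rho,\ q\text{ Hölder}\}$ | $0$ | $-(\vec\ell-\eta)_+$ | $0$ | $U$ | $1$ | | GDRO | $q^\top\vec\ell-\beta\sum_iq_i\log q_i$ | $B_{\mathcal{GW}}$ | $0$ | $-\vec\ell$ | $\beta$ | $B_{\mathcal{GW}}$ | $\rho$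 | | GCDRO | $\mathcal R_N$ | $B_{\mathcal{GW}}$ | $K_{ij}=\frac\alpha2w_{ij}(\ell_i-\ell_j)^2$ on $E$, else $0$ | $-\vec\ell$ | $\beta$ | $B_{\mathcal{GW}}$ | $\rho$ | Here $\mathcal R_N(\theta,q)=q^\top\vec\ell-\frac\alpha2\sum_{(i,j)\in E}w_{ij}q_iq_j(\ell_i-\ell_j)^2-\beta\sum_iq_i\log q_i$. Moreover: * For the first three methods, with $D=D_{\rm KL},\,D_{\chi^2},\,\mathrm{MMD}^2$ respectively, the Lagrangian of the DRO problem is the free-energy objective: $q^\top\vec\ell+\lambda(\rho-D(q))=\lambda'\rho'-\mathcal E(q,\theta,\lambda')$ for all $\theta$, all $\lambda\ge0$ and all $q\in\Delta_N$, where $\lambda'=N\lambda$ for $\chi^2$-DRO and $\lambda'=\lambda$ otherwise. * For marginal $\chi^2$-DRO (with no sign condition on $\ell$), for every $\theta$, $$\sup_{q\in U}q^\top\vec\ell=\min_{\eta\in\mathbb R}\ \sup_q\Big\{\eta+\sum_iq_i(\ell_i-\eta)\Big\},$$ where $q$ runs over the Hölder $q\in\mathbb R^N_{\ge 0}$ with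 $\frac1N\sum_i(Nq_i)^2\le1+\rho$, and the minimum over $\eta$ is attained. * For the first four methods the maxima over $U$ and, for every $\theta$ and $\lambda\ge0$, over $\mathscr P$ are attained. * For GCDRO, $\mathcal R_N(\theta,q)=-\mathcal E(q,\theta,\lambda)$ for all $q\in\mathbb R^N$. -/

import Mathlib

open scoped Matrix ENNReal

noncomputable section

namespace DRO

/-! ### Samples, losses, probability vectors -/

/-- The vector of prediction errors `ℓ_i(θ) = ℓ(f_θ(x_i), y_i)`. -/
def sampleLoss {Θ X Y : Type*} {N : ℕ} (f : Θ → X → Y) (loss : Y → Y → ℝ)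
    (x : Fin N → X) (y : Fin N → Y) (θ : Θ) : Fin N → ℝ :=
  fun i => loss (f θ (x i)) (y i)

/-- The weights of the empirical distribution. -/
def empirical (N : ℕ) : Fin N → ℝ := fun _ => 1 / (N : ℝ)

/-- The probability simplex `Δ_N`. -/
def simplex (N : ℕ) : Set (Fin N → ℝ) := stdSimplex ℝ (Fin N)

/-- The relative interior of the probability simplex. -/
def openSimplex (N : ℕ) : Set (Fin N → ℝ) := {p | (∀ i, 0 < p i) ∧ ∑ i, p i = 1}

/-- Shannon entropy `H[q] = - ∑ q_i log q_i`, with `0 log 0 = 0`. -/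
def entropy {N : ℕ} (q : Fin N → ℝ) : ℝ := ∑ i, Real.negMulLog (q i)

/-- The expected loss `E_q[ℓ] = ∑ q_i ℓ_i(θ)`. -/
def expectedLoss {Θ : Type*} {N : ℕ} (ℓ : Θ → Fin N → ℝ) (θ : Θ) (q : Fin N → ℝ) : ℝ :=
  ∑ i, q i * ℓ θ i

/-! ### Distances between weights on the sample -/

/-- The `φ`-divergence `∑ p_i φ(q_i / p_i)`; it is only used for `p` with positive entries. -/
def phiDiv {N : ℕ} (φ : ℝ → ℝ) (q p : Fin N → ℝ) : ℝ := ∑ i, p i * φ (q i / p i)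

/-- Kullback-Leibler divergence, `φ(t) = t log t`. -/
def klDivergence {N : ℕ} (q p : Fin N → ℝ) : ℝ := phiDiv (fun t => t * Real.log t) q p

/-- `χ²`-divergence, `φ(t) = (t - 1)²`. -/
def chiSqDivergence {N : ℕ} (q p : Fin N → ℝ) : ℝ := phiDiv (fun t => (t - 1) ^ 2) q p

/-- Maximum mean discrepancy between the distributions `∑ q_i δ_{z_i}` and `∑ p_i δ_{z_i}`:
the supremum, over the unit ball of the reproducing kernel Hilbert space `H`, of the difference
of the two expectations. -/
def mmd {Z : Type*} {N : ℕ} (H : Type*) [NormedAddCommGroup H] [InnerProductSpace ℝ H]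
    [RKHS ℝ H Z ℝ] (z : Fin N → Z) (q p : Fin N → ℝ) : ℝ :=
  ⨆ h : {h : H // ‖h‖ ≤ 1}, ((∑ i, q i * h.1 (z i)) - ∑ i, p i * h.1 (z i))

/-- The Gram matrix `K_ij = k(z_i, z_j)` of the reproducing kernel `k` of `H`. -/
def gram {Z : Type*} {N : ℕ} (H : Type*) [NormedAddCommGroup H] [InnerProductSpace ℝ H]
    [RKHS ℝ H Z ℝ] [CompleteSpace H] (z : Fin N → Z) : Matrix (Fin N) (Fin N) ℝ :=
  Matrix.of fun i j => RKHS.kernel H (z i) (z j) 1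

/-! ### Discrete geometric Wasserstein distance -/

/-- A finite weighted graph on `N` nodes, with symmetric weights that are positive on edges. -/
structure WeightedGraph (N : ℕ) where
  graph : SimpleGraph (Fin N)
  weight : Fin N → Fin N → ℝ
  weight_symm : ∀ i j, weight i j = weight j i
  weight_pos : ∀ i j, graph.Adj i j → 0 < weight i j

open Classical in
/-- `∑_{(i,j) ∈ E} F i j`, over ordered pairs of adjacent nodes. -/
def WeightedGraph.edgeSum {N : ℕ} (G : WeightedGraph N) (F : Fin N → Fin N → ℝ) : ℝ :=
  ∑ i, ∑ j, if G.graph.Adj i j then F i j else 0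

/-- An interpolation of the densities at the two ends of an edge: `val a b v` is `ξ_ij` for
`a = p_i`, `b = p_j`, `v = v_ij`. It may depend on the velocity, as the upwind one does. -/
structure Interpolation where
  val : ℝ → ℝ → ℝ → ℝ
  measurable_val : Measurable fun t : ℝ × ℝ × ℝ => val t.1 t.2.1 t.2.2
  min_le_val : ∀ a b v, 0 ≤ a → 0 ≤ b → min a b ≤ val a b v
  val_le_max : ∀ a b v, 0 ≤ a → 0 ≤ b → val a b v ≤ max a b
  val_symm : ∀ a b v, v ≠ 0 → val a b v = val b a (-v)

/-- The upwind interpolation `ξ_ij = p_j` if `v_ij > 0`, and `p_i` otherwise. -/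
def Interpolation.upwind : Interpolation where
  val a b v := if 0 < v then b else a
  measurable_val := by
    refine Measurable.ite ?_ (by fun_prop) (by fun_prop)
    exact measurableSet_lt measurable_const (by fun_prop)
  min_le_val a b v _ _ := by split_ifs <;> simp
  val_le_max a b v _ _ := by split_ifs <;> simp
  val_symm a b v hv := by
    rcases lt_or_gt_of_ne hv with h | h
    · rw [if_neg (not_lt.2 h.le), if_pos (by linarith)]
    · rw [if_pos h, if_neg (by linarith)]

open Classical in
/-- The divergence of the flux `p v`:
`div(p v)_i = - ∑_{j : (i,j) ∈ E} √w_ij v_ij ξ_ij(p)`. -/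
def divergence {N : ℕ} (G : WeightedGraph N) (ξ : Interpolation) (p : Fin N → ℝ)
    (v : Fin N → Fin N → ℝ) (i : Fin N) : ℝ :=
  -∑ j, if G.graph.Adj i j then Real.sqrt (G.weight i j) * v i j * ξ.val (p i) (p j) (v i j)
    else 0

/-- `p` is a curve in the interior of the simplex from `p₀` to `p₁`, and `v` a velocity field on
the graph, with `dp/dt + div(p v) = 0` on `[0,1]`. -/
structure IsTransport {N : ℕ} (G : WeightedGraph N) (ξ : Interpolation) (p₀ p₁ : Fin N → ℝ)
    (p : ℝ → Fin N → ℝ) (v : ℝ → Fin N → Fin N → ℝ) : Prop where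
  mem : ∀ t ∈ Set.Icc (0 : ℝ) 1, p t ∈ openSimplex N
  antisymm : ∀ t ∈ Set.Icc (0 : ℝ) 1, ∀ i j, G.graph.Adj i j → v t i j = -v t j i
  measurable : ∀ i j, Measurable fun t => v t i j
  continuity : ∀ t ∈ Set.Icc (0 : ℝ) 1,
    HasDerivWithinAt p (-divergence G ξ (p t) (v t)) (Set.Icc 0 1) t
  start : p 0 = p₀
  finish : p 1 = p₁

/-- The squared discrete geometric Wasserstein distance, the least kinetic energy
`∫₀¹ ½ ∑_{(i,j) ∈ E} ξ_ij(p(t)) v_ij(t)² dt` of a transport from `p₀` to `p₁`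
(`∞` if there is none). -/
def gwSq {N : ℕ} (G : WeightedGraph N) (ξ : Interpolation) (p₀ p₁ : Fin N → ℝ) : ℝ≥0∞ :=
  ⨅ (p : ℝ → Fin N → ℝ) (v : ℝ → Fin N → Fin N → ℝ) (_ : IsTransport G ξ p₀ p₁ p v),
    ∫⁻ t in Set.Icc (0 : ℝ) 1, ENNReal.ofReal
      (1 / 2 * G.edgeSum fun i j => ξ.val (p t i) (p t j) (v t i j) * v t i j ^ 2)

/-! ### Uncertainty sets -/

def klBall (N : ℕ) (ρ : ℝ) : Set (Fin N → ℝ) :=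
  {q | q ∈ simplex N ∧ klDivergence q (empirical N) ≤ ρ}

def chiSqBall (N : ℕ) (ρ : ℝ) : Set (Fin N → ℝ) :=
  {q | q ∈ simplex N ∧ chiSqDivergence q (empirical N) ≤ ρ}

def mmdBall {Z : Type*} {N : ℕ} (H : Type*) [NormedAddCommGroup H] [InnerProductSpace ℝ H]
    [RKHS ℝ H Z ℝ] (z : Fin N → Z) (ρ : ℝ) : Set (Fin N → ℝ) :=
  {q | q ∈ simplex N ∧ mmd H z q (empirical N) ^ 2 ≤ ρ}

/-- The density `h(x_i) = N q_i` with respect to the empirical distribution is Hölder continuous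
in the covariates, with constant `L` and exponent `s`. -/
def HolderDensity {X : Type*} [PseudoMetricSpace X] {N : ℕ} (x : Fin N → X) (L s : ℝ)
    (q : Fin N → ℝ) : Prop :=
  ∀ i j, |(N : ℝ) * q i - (N : ℝ) * q j| ≤ L * dist (x i) (x j) ^ s

/-- The uncertainty set of marginal `χ²`-DRO: the `χ²`-ball, restricted to Hölder densities. -/
def marginalBall {X : Type*} [PseudoMetricSpace X] {N : ℕ} (x : Fin N → X) (L s ρ : ℝ) :
    Set (Fin N → ℝ) :=
  {q | q ∈ chiSqBall N ρ ∧ HolderDensity x L s q}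

/-- The nonnegative weights, not necessarily of total mass one, whose density has second moment at
most `1 + ρ` and is Hölder continuous. Those of total mass one form `marginalBall`. -/
def marginalCone {X : Type*} [PseudoMetricSpace X] {N : ℕ} (x : Fin N → X) (L s ρ : ℝ) :
    Set (Fin N → ℝ) :=
  {q | (∀ i, 0 ≤ q i) ∧ 1 / (N : ℝ) * ∑ i, ((N : ℝ) * q i) ^ 2 ≤ 1 + ρ ∧ HolderDensity x L s q}

/-- The geometric Wasserstein set. -/
def gwBall {N : ℕ} (G : WeightedGraph N) (ξ : Interpolation) (ρ : ℝ) : Set (Fin N → ℝ) :=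
  {q | q ∈ openSimplex N ∧ gwSq G ξ (empirical N) q ≤ ENNReal.ofReal ρ}

/-! ### Risks of the geometric methods -/

/-- The objective of GCDRO: expected loss minus graph total variation minus `β ∑ q_i log q_i`. -/
def gcdroRisk {Θ : Type*} {N : ℕ} (ℓ : Θ → Fin N → ℝ) (G : WeightedGraph N) (α β : ℝ)
    (θ : Θ) (q : Fin N → ℝ) : ℝ :=
  ∑ i, q i * ℓ θ i
    - α / 2 * G.edgeSum (fun i j => G.weight i j * q i * q j * (ℓ θ i - ℓ θ j) ^ 2)
    - β * ∑ i, q i * Real.log (q i)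

/-- The objective of GDRO: expected loss minus `β ∑ q_i log q_i`. -/
def gdroRisk {Θ : Type*} {N : ℕ} (ℓ : Θ → Fin N → ℝ) (β : ℝ) (θ : Θ) (q : Fin N → ℝ) : ℝ :=
  ∑ i, q i * ℓ θ i - β * ∑ i, q i * Real.log (q i)

/-! ### Free energy and the minimax problem -/

/-- The data `K, V, β, 𝒫, ρ` of a free-energy minimax problem. The interaction matrix and the
potential may depend on `θ` and `λ`, the temperature on `λ`. -/
structure FreeEnergyModel (Θ : Type*) (N : ℕ) where
  interaction : Θ → ℝ → Matrix (Fin N) (Fin N) ℝ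
  potential : Θ → ℝ → Fin N → ℝ
  temperature : ℝ → ℝ
  feasible : Set (Fin N → ℝ)
  radius : ℝ

namespace FreeEnergyModel

variable {Θ : Type*} {N : ℕ}

/-- Helmholtz free energy `𝓔(q, θ, λ) = qᵀ K q + qᵀ V - β H[q]`. -/
def energy (F : FreeEnergyModel Θ N) (q : Fin N → ℝ) (θ : Θ) (lam : ℝ) : ℝ :=
  q ⬝ᵥ (F.interaction θ lam *ᵥ q) + q ⬝ᵥ F.potential θ lam - F.temperature lam * entropy q

/-- The objective `λ ρ - 𝓔(q, θ, λ)`. -/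
def objective (F : FreeEnergyModel Θ N) (θ : Θ) (lam : ℝ) (q : Fin N → ℝ) : ℝ :=
  lam * F.radius - F.energy q θ lam

/-- The value of the inner maximization over `q ∈ 𝒫`. -/
def value (F : FreeEnergyModel Θ N) (θ : Θ) (lam : ℝ) : EReal :=
  ⨆ q ∈ F.feasible, (F.objective θ lam q : EReal)

end FreeEnergyModel

/-- The worst-case risk `sup_{q ∈ U} R(θ, q)`. -/
def worstCase {Θ : Type*} {N : ℕ} (U : Set (Fin N → ℝ)) (R : Θ → (Fin N → ℝ) → ℝ) (θ : Θ) :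
    EReal :=
  ⨆ q ∈ U, (R θ q : EReal)

/-- The problem `min_θ sup_{q ∈ U} R(θ, q)` is equivalent to
`min_{θ, λ ≥ 0} max_{q ∈ 𝒫} {λ ρ - 𝓔(q, θ, λ)}`. -/
structure EquivFreeEnergy {Θ : Type*} {N : ℕ} (U : Set (Fin N → ℝ))
    (R : Θ → (Fin N → ℝ) → ℝ) (F : FreeEnergyModel Θ N) : Prop where
  /-- the worst-case risk is a real number -/
  finite : ∀ θ, worstCase U R θ ≠ ⊥ ∧ worstCase U R θ ≠ ⊤
  /-- for each `θ` it is the minimum over `λ ≥ 0` of the inner value, and is attained -/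
  isLeast : ∀ θ, IsLeast (F.value θ '' Set.Ici 0) (worstCase U R θ)
  /-- the optimal values agree -/
  optimalValue : ⨅ θ, worstCase U R θ = ⨅ θ, ⨅ lam ∈ Set.Ici (0 : ℝ), F.value θ lam
  /-- the optimal parameters agree -/
  minimizers : ∀ θ, (∀ θ', worstCase U R θ ≤ worstCase U R θ') ↔
    ∃ lam, 0 ≤ lam ∧ ∀ θ' lam', 0 ≤ lam' → F.value θ lam ≤ F.value θ' lam'

/-- `f` attains its maximum on `P`. -/
def MaxAttained {N : ℕ} (P : Set (Fin N → ℝ)) (f : (Fin N → ℝ) → ℝ) : Prop :=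
  ∃ q ∈ P, IsMaxOn f P q

/-! ### The specific free energies -/

section Models

variable {Θ : Type*} {N : ℕ} (ℓ : Θ → Fin N → ℝ)

def klModel (ρ : ℝ) : FreeEnergyModel Θ N where
  interaction _ _ := 0
  potential θ _ := -ℓ θ
  temperature lam := lam
  feasible := simplex N
  radius := ρ - Real.log N

def chiSqModel (ρ : ℝ) : FreeEnergyModel Θ N where
  interaction _ lam := lam • (1 : Matrix (Fin N) (Fin N) ℝ)
  potential θ _ := -ℓ θ
  temperature _ := 0
  feasible := simplex N
  radius := (1 + ρ) / N

/-- The argument `K` is the kernel Gram matrix. -/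
def mmdModel (K : Matrix (Fin N) (Fin N) ℝ) (ρ : ℝ) : FreeEnergyModel Θ N where
  interaction _ lam := lam • K
  potential θ lam := -ℓ θ - (2 * lam / N) • (Kᵀ *ᵥ 1)
  temperature _ := 0
  feasible := simplex N
  radius := ρ - 1 / (N : ℝ) ^ 2 * ((1 : Fin N → ℝ) ⬝ᵥ (K *ᵥ 1))

/-- Here `λ` is the dual parameter written `η` in `V = -(ℓ - η)₊`. -/
def marginalModel {X : Type*} [PseudoMetricSpace X] (x : Fin N → X) (L s ρ : ℝ) :
    FreeEnergyModel Θ N where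
  interaction _ _ := 0
  potential θ lam := fun i => -(max (ℓ θ i - lam) 0)
  temperature _ := 0
  feasible := marginalBall x L s ρ
  radius := 1

def gdroModel (G : WeightedGraph N) (ξ : Interpolation) (β ρ : ℝ) : FreeEnergyModel Θ N where
  interaction _ _ := 0
  potential θ _ := -ℓ θ
  temperature _ := β
  feasible := gwBall G ξ ρ
  radius := ρ

open Classical in
def gcdroModel (G : WeightedGraph N) (ξ : Interpolation) (α β ρ : ℝ) : FreeEnergyModel Θ N where
  interaction θ _ := Matrix.of fun i j =>
    if G.graph.Adj i j then α / 2 * G.weight i j * (ℓ θ i - ℓ θ j) ^ 2 else 0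
  potential θ _ := -ℓ θ
  temperature _ := β
  feasible := gwBall G ξ ρ
  radius := ρ

end Models

end DRO

end

namespace DRO

/-! ### Lagrange multipliers for one scalar constraint -/

section Multipliers

/-! Three mechanisms are at work.

For KL, χ² and MMD the penalty expands, on vectors of mass one, into terms of the free energy: KL is
`log N - H`, χ² is `N (q ⬝ᵥ q) - 1`, and MMD² is the Gram quadratic form at `q - empirical N`. The
Lagrangian is therefore the free-energy objective, and what remains is strong duality
(`EquivFreeEnergy.of_lagrangian`). The risk is linear, the penalty is convex, and the empirical
weights, where the penalty is `0 < ρ`, are a Slater point. With one scalar constraint the multiplier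
needs no separation theorem: it is a supremum of slopes (`exists_slope`).

For marginal χ² the objective at `η` is `∑ q_i max(ℓ_i, η)`, so with `ℓ ≥ 0` the minimum over `η ≥
0` sits at `η = 0`. The other dual form relaxes `∑ q_i = 1` over a convex set in which the mass lies
on both sides of `1`, so the multiplier of this equality has no sign.

For GDRO and GCDRO the risk is the negative of the energy and the constraint stays in the feasible
set. The objective is `λ ρ + R`, minimal at `λ = 0`; only nonemptiness and boundedness need proof.
-/

lemma exists_slope {E : Type*} {C : Set E} {g r : E → ℝ}
    (hcross : ∀ p ∈ C, ∀ q ∈ C, g p < 0 → 0 < g q →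
      r p * g q + r q * (-g p) ≤ 0)
    (hzero : ∀ q ∈ C, g q = 0 → r q ≤ 0)
    (hneg : ∃ p ∈ C, g p < 0) (hpos : ∃ q ∈ C, 0 < g q) :
    ∃ lam : ℝ, ∀ q ∈ C, r q ≤ lam * g q := by
  -- By `hcross`, every slope `r / g` at a point with `g > 0` is at most every slope at a point with
  -- `g < 0`. The supremum of the former separates the two families.
  set S : Set ℝ := {t | ∃ q ∈ C, 0 < g q ∧ t = r q / g q} with hS
  have hbound : ∀ p ∈ C, g p < 0 → r p / g p ∈ upperBounds S := by
    rintro p hp hgp _ ⟨q, hq, hgq, rfl⟩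
    have h := hcross p hp q hq hgp hgq
    rw [← neg_div_neg_eq (r p), div_le_div_iff₀ hgq (by linarith)]
    linarith
  obtain ⟨p₀, hp₀, hgp₀⟩ := hneg
  obtain ⟨q₀, hq₀, hgq₀⟩ := hpos
  have hne : S.Nonempty := ⟨_, q₀, hq₀, hgq₀, rfl⟩
  have hbdd : BddAbove S := ⟨_, hbound p₀ hp₀ hgp₀⟩
  refine ⟨sSup S, fun q hq => ?_⟩
  rcases lt_trichotomy (g q) 0 with h | h | h
  · have := csSup_le hne (hbound q hq h)
    rwa [le_div_iff_of_neg h] at this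
  · rw [h, mul_zero]
    exact hzero q hq h
  · have := le_csSup hbdd ⟨q, hq, h, rfl⟩
    rwa [div_le_iff₀ h] at this

variable {E : Type*} [AddCommGroup E] [Module ℝ E] {C : Set E} {g r : E → ℝ}

/-- If the concave function `r` is nonpositive at the points of the segment from `p` to `q` where
the interpolation of `g p < 0 < g q` vanishes, then so is the corresponding average of `r`. -/
lemma cross_le_zero (hr : ConcaveOn ℝ C r) {p q : E} (hp : p ∈ C) (hq : q ∈ C)
    (hgp : g p < 0) (hgq : 0 < g q)
    (h : ∀ a b : ℝ, 0 ≤ a → 0 ≤ b → a + b = 1 → a * g p + b * g q = 0 → r (a • p + b • q) ≤ 0) :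
    r p * g q + r q * (-g p) ≤ 0 := by
  have hd : 0 < g q - g p := by linarith
  -- The weights on `p` and `q` are those at which the interpolation of `g` vanishes.
  have ha : 0 ≤ g q / (g q - g p) := by positivity
  have hb : 0 ≤ -g p / (g q - g p) := div_nonneg (by linarith) hd.le
  have hab : g q / (g q - g p) + -g p / (g q - g p) = 1 := by
    field_simp
    ring
  have h1 := (hr.2 hp hq ha hb hab).trans (h _ _ ha hb hab (by ring))
  have h2 : (r p * g q + r q * (-g p)) / (g q - g p) ≤ 0 := by
    refine le_of_eq_of_le ?_ h1
    simp only [smul_eq_mul]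
    ring
  by_contra hcon
  exact absurd h2 (not_le.2 (div_pos (not_le.1 hcon) hd))

/-- Lagrange multiplier for a convex inequality constraint satisfying Slater's condition. -/
lemma exists_multiplier (hg : ConvexOn ℝ C g) (hr : ConcaveOn ℝ C r)
    (hfeas : ∀ q ∈ C, g q ≤ 0 → r q ≤ 0) (hneg : ∃ p ∈ C, g p < 0) :
    ∃ lam : ℝ, 0 ≤ lam ∧ ∀ q ∈ C, r q ≤ lam * g q := by
  by_cases hpos : ∃ q ∈ C, 0 < g q
  · obtain ⟨lam, hlam⟩ := exists_slope
      (fun p hp q hq hgp hgq => cross_le_zero hr hp hq hgp hgq fun a b ha hb hab h0 =>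
        hfeas _ (hg.1 hp hq ha hb hab) ((hg.2 hp hq ha hb hab).trans h0.le)) (fun q hq h => hfeas q hq h.le) hneg hpos
    -- Raising a negative slope to `0` only weakens the bound where `g > 0`; where `g ≤ 0`,
    -- feasibility already gives `r ≤ 0`.
    refine ⟨max lam 0, le_max_right _ _, fun q hq => ?_⟩
    rcases le_or_gt (g q) 0 with h | h
    · rcases max_cases lam 0 with ⟨e, -⟩ | ⟨e, -⟩ <;> rw [e]
      · exact hlam q hq
      · simpa using hfeas q hq h
    · exact (hlam q hq).trans (mul_le_mul_of_nonneg_right (le_max_left _ _) h.le)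
  · push Not at hpos
    exact ⟨0, le_rfl, fun q hq => by simpa using hfeas q hq (hpos q hq)⟩

/-- Lagrange multiplier for an affine equality constraint that takes both signs. -/
lemma exists_multiplier_of_affine (hg : ConvexOn ℝ C g) (hg' : ConcaveOn ℝ C g)
    (hr : ConcaveOn ℝ C r) (hfeas : ∀ q ∈ C, g q = 0 → r q ≤ 0)
    (hneg : ∃ p ∈ C, g p < 0) (hpos : ∃ q ∈ C, 0 < g q) :
    ∃ lam : ℝ, ∀ q ∈ C, r q ≤ lam * g q := by
  refine exists_slope (fun p hp q hq hgp hgq => cross_le_zero hr hp hq hgp hgq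
    fun a b ha hb hab h0 => hfeas _ (hg.1 hp hq ha hb hab) (le_antisymm ?_ ?_)) hfeas hneg hpos
  · exact (hg.2 hp hq ha hb hab).trans h0.le
  · exact h0.ge.trans (hg'.2 hp hq ha hb hab)

end Multipliers

/-! ### Criteria for equivalence with a free-energy problem -/

section Equivalence

variable {Θ : Type*} {N : ℕ} {U : Set (Fin N → ℝ)} {R : Θ → (Fin N → ℝ) → ℝ}
  {F : FreeEnergyModel Θ N}

/-- The statements on optimal values and minimizers are formal: a `λ` attaining the inner minimum
turns an optimal `θ` into an optimal pair, and conversely. -/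
lemma EquivFreeEnergy.of_isLeast
    (hfin : ∀ θ, worstCase U R θ ≠ ⊥ ∧ worstCase U R θ ≠ ⊤)
    (hleast : ∀ θ, IsLeast (F.value θ '' Set.Ici 0) (worstCase U R θ)) :
    EquivFreeEnergy U R F where
  finite := hfin
  isLeast := hleast
  optimalValue := by
    refine iInf_congr fun θ => ?_
    rw [← sInf_image]
    exact (hleast θ).isGLB.sInf_eq.symm
  minimizers θ := by
    constructor
    · intro h
      obtain ⟨lam, hlam, he⟩ := (hleast θ).1
      refine ⟨lam, hlam, fun θ' lam' hlam' => ?_⟩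
      rw [he]
      exact (h θ').trans ((hleast θ').2 ⟨lam', hlam', rfl⟩)
    · rintro ⟨lam, hlam, h⟩ θ'
      obtain ⟨lam', hlam', he⟩ := (hleast θ').1
      rw [← he]
      exact ((hleast θ).2 ⟨lam, hlam, rfl⟩).trans (h θ' lam' hlam')

lemma worstCase_ne_bot_and_ne_top {θ : Θ} (hne : U.Nonempty) {M : ℝ} (hM : ∀ q ∈ U, R θ q ≤ M) :
    worstCase U R θ ≠ ⊥ ∧ worstCase U R θ ≠ ⊤ := by
  obtain ⟨q, hq⟩ := hne
  constructor
  · exact ne_bot_of_le_ne_bot (EReal.coe_ne_bot (R θ q))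
      (le_iSup₂ (f := fun q (_ : q ∈ U) => (R θ q : EReal)) q hq)
  · exact ne_top_of_le_ne_top (EReal.coe_ne_top M)
      (iSup₂_le fun q hq => EReal.coe_le_coe_iff.2 (hM q hq))

lemma worstCase_eq_of_isMaxOn {θ : Θ} {q : Fin N → ℝ} (hq : q ∈ U) (hmax : IsMaxOn (R θ) U q) :
    worstCase U R θ = (R θ q : EReal) :=
  le_antisymm (iSup₂_le fun _ hp => EReal.coe_le_coe_iff.2 (hmax hp))
    (le_iSup₂ (f := fun q (_ : q ∈ U) => (R θ q : EReal)) q hq)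

lemma MaxAttained.of_isCompact {P : Set (Fin N → ℝ)} {f : (Fin N → ℝ) → ℝ} (hP : IsCompact P)
    (hne : P.Nonempty) (hf : Continuous f) : MaxAttained P f :=
  hP.exists_isMaxOn hne hf.continuousOn

/-- Strong duality: a convex constraint `D ≤ ρ` on the feasible set, whose Lagrangian is the
free-energy objective up to a positive rescaling of the multiplier. -/
lemma EquivFreeEnergy.of_lagrangian {D : (Fin N → ℝ) → ℝ} {ρ c : ℝ} (hc : 0 < c)
    (hU : U = {q | q ∈ F.feasible ∧ D q ≤ ρ})
    (hL : ∀ θ lam, 0 ≤ lam → ∀ q ∈ F.feasible,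
      R θ q + lam * (ρ - D q) = F.objective θ (c * lam) q)
    (hD : ConvexOn ℝ F.feasible D) (hR : ∀ θ, ConcaveOn ℝ F.feasible (R θ))
    (hslater : ∃ q ∈ F.feasible, D q < ρ) (hmax : ∀ θ, MaxAttained U (R θ)) :
    EquivFreeEnergy U R F := by
  refine .of_isLeast (fun θ => ?_) (fun θ => ?_)
  · obtain ⟨q, hq, hq'⟩ := hmax θ
    exact worstCase_ne_bot_and_ne_top ⟨q, hq⟩ fun p hp => hq' hp
  · obtain ⟨m, hm, hm'⟩ := hmax θ
    have hle : ∀ lam, 0 ≤ lam → worstCase U R θ ≤ F.value θ lam := by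
      intro lam hlam
      refine iSup₂_le fun q hq => ?_
      rw [hU] at hq
      refine le_iSup₂_of_le (f := fun q (_ : q ∈ F.feasible) => (F.objective θ lam q : EReal))
        q hq.1 (EReal.coe_le_coe_iff.2 ?_)
      -- Weak duality: the objective at `lam` is the Lagrangian with multiplier `lam / c`, whose
      -- penalty term is nonnegative on `U`.
      have h := hL θ (lam / c) (by positivity) q hq.1
      rw [mul_div_cancel₀ _ hc.ne'] at h
      rw [← h]
      have : 0 ≤ lam / c * (ρ - D q) := mul_nonneg (by positivity) (sub_nonneg.2 hq.2)
      linarith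
    -- With `r` the excess of the risk over its maximum on `U`, the bound `r ≤ lam * g` says that
    -- the Lagrangian never exceeds that maximum.
    obtain ⟨lam, hlam, h⟩ := exists_multiplier (C := F.feasible) (g := fun q => D q - ρ)
      (r := fun q => R θ q - R θ m) (hD.sub (concaveOn_const ρ hD.1))
      ((hR θ).sub (convexOn_const (R θ m) hD.1))
      (fun q hq h => sub_nonpos.2 (hm' (by rw [hU]; exact ⟨hq, sub_nonpos.1 h⟩)))
      (by simpa only [sub_neg] using hslater)
    refine ⟨⟨c * lam, mul_nonneg hc.le hlam, le_antisymm (iSup₂_le fun q hq => ?_)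
      (hle _ (mul_nonneg hc.le hlam))⟩, ?_⟩
    · rw [worstCase_eq_of_isMaxOn hm hm', EReal.coe_le_coe_iff, ← hL θ lam hlam q hq]
      linarith [h q hq]
    · rintro _ ⟨lam', hlam', rfl⟩
      exact hle lam' hlam'

/-- If the objective on the uncertainty set is `λ ρ + R` with `ρ ≥ 0`, then `λ = 0` is optimal. -/
lemma EquivFreeEnergy.of_objective_eq (hne : F.feasible.Nonempty) (hρ : 0 ≤ F.radius)
    (hbdd : ∀ θ, ∃ M, ∀ q ∈ F.feasible, R θ q ≤ M)
    (hobj : ∀ θ lam q, F.objective θ lam q = lam * F.radius + R θ q) :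
    EquivFreeEnergy F.feasible R F := by
  refine .of_isLeast (fun θ => ?_) (fun θ => ⟨⟨0, Set.self_mem_Ici, ?_⟩, ?_⟩)
  · obtain ⟨M, hM⟩ := hbdd θ
    exact worstCase_ne_bot_and_ne_top hne hM
  · simp only [FreeEnergyModel.value, worstCase, hobj, zero_mul, zero_add]
  · rintro _ ⟨lam, hlam, rfl⟩
    refine iSup₂_mono fun q _ => EReal.coe_le_coe_iff.2 ?_
    rw [hobj]
    have := mul_nonneg hlam hρ
    linarith

end Equivalence

/-! ### The simplex and the divergences -/

section Divergences

variable {N : ℕ}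

lemma empirical_mem_openSimplex (hN : 0 < N) : empirical N ∈ openSimplex N := by
  have : (0 : ℝ) < N := Nat.cast_pos.2 hN
  refine ⟨fun i => by simp only [empirical]; positivity, ?_⟩
  simp only [empirical, Finset.sum_const, Finset.card_univ, Fintype.card_fin, nsmul_eq_mul]
  field_simp

lemma openSimplex_subset_simplex : openSimplex N ⊆ simplex N :=
  fun _ hq => ⟨fun i => (hq.1 i).le, hq.2⟩

lemma empirical_mem_simplex (hN : 0 < N) : empirical N ∈ simplex N :=
  openSimplex_subset_simplex (empirical_mem_openSimplex hN)

lemma isCompact_simplex : IsCompact (simplex N) := isCompact_stdSimplex ℝ (Fin N)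

lemma convex_simplex : Convex ℝ (simplex N) := convex_stdSimplex ℝ (Fin N)

lemma continuous_phiDiv {φ : ℝ → ℝ} (hφ : Continuous φ) (p : Fin N → ℝ) :
    Continuous fun q => phiDiv φ q p := by
  unfold phiDiv
  fun_prop

lemma convexOn_phiDiv {φ : ℝ → ℝ} (hφ : ConvexOn ℝ (Set.Ici 0) φ) {p : Fin N → ℝ}
    (hp : ∀ i, 0 ≤ p i) : ConvexOn ℝ (simplex N) fun q => phiDiv φ q p := by
  refine ⟨convex_simplex, fun q hq r hr a b ha hb hab => ?_⟩
  simp only [phiDiv, smul_eq_mul, Finset.mul_sum, ← Finset.sum_add_distrib]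
  refine Finset.sum_le_sum fun i _ => ?_
  have h := hφ.2 (x := q i / p i) (div_nonneg (hq.1 i) (hp i)) (y := r i / p i)
    (div_nonneg (hr.1 i) (hp i)) ha hb hab
  simp only [smul_eq_mul] at h
  have h' : (a • q + b • r) i / p i = a * (q i / p i) + b * (r i / p i) := by
    simp only [Pi.add_apply, Pi.smul_apply, smul_eq_mul]
    ring
  rw [h']
  calc _ ≤ p i * (a * φ (q i / p i) + b * φ (r i / p i)) := mul_le_mul_of_nonneg_left h (hp i)
    _ = _ := by ring

lemma phiDiv_self {φ : ℝ → ℝ} (hφ : φ 1 = 0) {p : Fin N → ℝ} (hp : ∀ i, p i ≠ 0) :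
    phiDiv φ p p = 0 :=
  Finset.sum_eq_zero fun i _ => by rw [div_self (hp i), hφ, mul_zero]

lemma continuous_klDivergence : Continuous fun q => klDivergence q (empirical N) :=
  continuous_phiDiv Real.continuous_mul_log _

lemma continuous_chiSqDivergence : Continuous fun q => chiSqDivergence q (empirical N) :=
  continuous_phiDiv (by fun_prop) _

lemma convexOn_klDivergence : ConvexOn ℝ (simplex N) fun q => klDivergence q (empirical N) :=
  convexOn_phiDiv Real.convexOn_mul_log fun i => by simp only [empirical]; positivity

lemma convexOn_chiSqDivergence :
    ConvexOn ℝ (simplex N) fun q => chiSqDivergence q (empirical N) := by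
  refine convexOn_phiDiv ⟨convex_Ici 0, fun u _ v _ a b ha hb hab => ?_⟩
    fun i => by simp only [empirical]; positivity
  obtain rfl : b = 1 - a := by linarith
  simp only [smul_eq_mul]
  -- The convexity gap of the square is `a b (u - v)²`.
  nlinarith [mul_nonneg (mul_nonneg ha hb) (sq_nonneg (u - v))]

lemma klDivergence_empirical_self (hN : 0 < N) :
    klDivergence (empirical N) (empirical N) = 0 :=
  phiDiv_self (by simp) fun i => ((empirical_mem_openSimplex hN).1 i).ne'

lemma chiSqDivergence_empirical_self (hN : 0 < N) :
    chiSqDivergence (empirical N) (empirical N) = 0 :=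
  phiDiv_self (by simp) fun i => ((empirical_mem_openSimplex hN).1 i).ne'

lemma klDivergence_eq (hN : 0 < N) {q : Fin N → ℝ} (hq : q ∈ simplex N) :
    klDivergence q (empirical N) = Real.log N - entropy q := by
  have hN' : (N : ℝ) ≠ 0 := Nat.cast_ne_zero.2 hN.ne'
  -- Mass one spreads `log N` over the coordinates, so the identity can be checked termwise.
  have h1 : Real.log N = ∑ i, q i * Real.log N := by rw [← Finset.sum_mul, hq.2, one_mul]
  rw [h1]
  simp only [klDivergence, phiDiv, entropy, empirical, ← Finset.sum_sub_distrib]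
  refine Finset.sum_congr rfl fun i _ => ?_
  rcases eq_or_ne (q i) 0 with h | h
  · simp [h]
  · rw [one_div, div_inv_eq_mul, Real.log_mul h hN', Real.negMulLog]
    field_simp
    ring

/-- Mass one makes the linear term of the expanded square constant. The factor `N` left on the
quadratic term is why the multiplier gets rescaled. -/
lemma chiSqDivergence_eq (hN : 0 < N) {q : Fin N → ℝ} (hq : q ∈ simplex N) :
    chiSqDivergence q (empirical N) = N * (q ⬝ᵥ q) - 1 := by
  have hN' : (N : ℝ) ≠ 0 := Nat.cast_ne_zero.2 hN.ne'
  have h : ∀ i, empirical N i * (q i / empirical N i - 1) ^ 2 =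
      N * (q i * q i) - 2 * q i + 1 / N := by
    intro i
    simp only [empirical]
    field_simp
    ring
  simp only [chiSqDivergence, phiDiv, h, Finset.sum_add_distrib, Finset.sum_sub_distrib,
    ← Finset.mul_sum, hq.2, dotProduct, Finset.sum_const, Finset.card_univ, Fintype.card_fin,
    nsmul_eq_mul]
  field_simp
  ring

variable {Θ : Type*} (ℓ : Θ → Fin N → ℝ)

lemma continuous_expectedLoss (θ : Θ) : Continuous (expectedLoss ℓ θ) := by
  unfold expectedLoss
  fun_prop

lemma concaveOn_expectedLoss {C : Set (Fin N → ℝ)} (hC : Convex ℝ C) (θ : Θ) :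
    ConcaveOn ℝ C (expectedLoss ℓ θ) := by
  refine ⟨hC, fun p _ q _ a b _ _ _ => le_of_eq ?_⟩
  simp only [expectedLoss, smul_eq_mul, Finset.mul_sum, ← Finset.sum_add_distrib, Pi.add_apply,
    Pi.smul_apply]
  exact Finset.sum_congr rfl fun i _ => by ring

lemma continuous_entropy : Continuous (entropy : (Fin N → ℝ) → ℝ) := by
  unfold entropy
  fun_prop

lemma continuous_objective (F : FreeEnergyModel Θ N) (θ : Θ) (lam : ℝ) :
    Continuous (F.objective θ lam) := by
  have := continuous_entropy (N := N)
  unfold FreeEnergyModel.objective FreeEnergyModel.energy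
  fun_prop

lemma dotProduct_neg_potential (θ : Θ) (q : Fin N → ℝ) :
    q ⬝ᵥ (-ℓ θ) = -expectedLoss ℓ θ q := by
  rw [dotProduct_neg]
  rfl

lemma klModel_objective (hN : 0 < N) (ρ : ℝ) (θ : Θ) (lam : ℝ) {q : Fin N → ℝ}
    (hq : q ∈ simplex N) :
    expectedLoss ℓ θ q + lam * (ρ - klDivergence q (empirical N)) =
      (klModel ℓ ρ).objective θ lam q := by
  simp only [klModel, FreeEnergyModel.objective, FreeEnergyModel.energy, Matrix.zero_mulVec,
    dotProduct_zero, dotProduct_neg_potential, klDivergence_eq hN hq]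
  ring

lemma chiSqModel_objective (hN : 0 < N) (ρ : ℝ) (θ : Θ) (lam : ℝ) {q : Fin N → ℝ}
    (hq : q ∈ simplex N) :
    expectedLoss ℓ θ q + lam * (ρ - chiSqDivergence q (empirical N)) =
      (chiSqModel ℓ ρ).objective θ (N * lam) q := by
  have hN' : (N : ℝ) ≠ 0 := Nat.cast_ne_zero.2 hN.ne'
  simp only [chiSqModel, FreeEnergyModel.objective, FreeEnergyModel.energy, Matrix.smul_mulVec,
    Matrix.one_mulVec, dotProduct_smul, smul_eq_mul, dotProduct_neg_potential,
    chiSqDivergence_eq hN hq]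
  field_simp
  ring

end Divergences

/-! ### Maximum mean discrepancy -/

section MMD

variable {Z H : Type*} [NormedAddCommGroup H] [InnerProductSpace ℝ H] [RKHS ℝ H Z ℝ] {N : ℕ}

/-- Cauchy–Schwarz gives the upper bound, and `w / ‖w‖` attains it when `w ≠ 0`. -/
lemma ciSup_unitBall_inner (w : H) : ⨆ h : {h : H // ‖h‖ ≤ 1}, inner ℝ w h.1 = ‖w‖ := by
  have hle : ∀ h : {h : H // ‖h‖ ≤ 1}, inner ℝ w h.1 ≤ ‖w‖ := fun h =>
    (real_inner_le_norm w h.1).trans (mul_le_of_le_one_right (norm_nonneg _) h.2)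
  have : Nonempty {h : H // ‖h‖ ≤ 1} := ⟨⟨0, by simp⟩⟩
  refine le_antisymm (ciSup_le hle) ?_
  rcases eq_or_ne w 0 with rfl | hw
  · simp
  · have hw' : ‖w‖ ≠ 0 := norm_ne_zero_iff.2 hw
    refine le_ciSup_of_le ⟨‖w‖, by rintro _ ⟨h, rfl⟩; exact hle h⟩
      ⟨‖w‖⁻¹ • w, by rw [norm_smul, norm_inv, norm_norm, inv_mul_cancel₀ hw']⟩ ?_
    rw [real_inner_smul_right, real_inner_self_eq_norm_sq]
    field_simp
    rfl

variable [CompleteSpace H]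

/-- The mean embedding of the signed weights `a` on the sample. -/
noncomputable def embedding (H : Type*) [NormedAddCommGroup H] [InnerProductSpace ℝ H] [RKHS ℝ H Z ℝ]
    [CompleteSpace H] (z : Fin N → Z) (a : Fin N → ℝ) : H :=
  ∑ i, a i • RKHS.kerFun H (z i) 1

lemma embedding_combo (z : Fin N → Z) (a b : ℝ) (p q : Fin N → ℝ) :
    embedding H z (a • p + b • q) = a • embedding H z p + b • embedding H z q := by
  simp only [embedding, Finset.smul_sum, ← Finset.sum_add_distrib, smul_smul, ← add_smul,
    Pi.add_apply, Pi.smul_apply, smul_eq_mul]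

/-- By the reproducing property, the difference of expectations of `h` is its inner product with the
mean embedding of `q - p`. -/
lemma mmd_eq_norm (z : Fin N → Z) (q p : Fin N → ℝ) : mmd H z q p = ‖embedding H z (q - p)‖ := by
  rw [← ciSup_unitBall_inner]
  unfold mmd
  refine iSup_congr fun h => ?_
  simp [embedding, sum_inner, real_inner_smul_left, sub_mul, Finset.sum_sub_distrib]

lemma gram_eq_inner (z : Fin N → Z) (i j : Fin N) :
    gram H z i j = inner ℝ (RKHS.kerFun H (z i) 1) (RKHS.kerFun H (z j) 1) := by
  rw [RKHS.kerFun_inner]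
  simp [gram, RKHS.kerFun_apply]

lemma norm_embedding_sq (z : Fin N → Z) (a : Fin N → ℝ) :
    ‖embedding H z a‖ ^ 2 = a ⬝ᵥ (gram H z *ᵥ a) := by
  rw [← real_inner_self_eq_norm_sq]
  simp only [embedding, sum_inner, inner_sum, real_inner_smul_left, real_inner_smul_right,
    dotProduct, Matrix.mulVec, gram_eq_inner, Finset.mul_sum]
  rw [Finset.sum_comm]
  refine Finset.sum_congr rfl fun i _ => Finset.sum_congr rfl fun j _ => ?_
  rw [real_inner_comm]
  ring

lemma gram_transpose (z : Fin N → Z) : (gram H z)ᵀ = gram H z := by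
  ext i j
  rw [Matrix.transpose_apply, gram_eq_inner, gram_eq_inner, real_inner_comm]

lemma mmd_sq_eq (z : Fin N → Z) (q : Fin N → ℝ) :
    mmd H z q (empirical N) ^ 2 = q ⬝ᵥ (gram H z *ᵥ q)
      - 2 / N * (q ⬝ᵥ (gram H z *ᵥ 1)) + 1 / (N : ℝ) ^ 2 * (1 ⬝ᵥ (gram H z *ᵥ 1)) := by
  have he : empirical N = (1 / (N : ℝ)) • (1 : Fin N → ℝ) := by
    ext i
    simp [empirical]
  -- Symmetry of the Gram matrix merges the two cross terms of the expansion.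
  have hs : (1 : Fin N → ℝ) ⬝ᵥ (gram H z *ᵥ q) = q ⬝ᵥ (gram H z *ᵥ 1) := by
    rw [Matrix.dotProduct_mulVec, ← Matrix.mulVec_transpose, gram_transpose, dotProduct_comm]
  rw [mmd_eq_norm, norm_embedding_sq, he, Matrix.mulVec_sub, Matrix.mulVec_smul,
    sub_dotProduct, dotProduct_sub, dotProduct_sub, smul_dotProduct, smul_dotProduct,
    dotProduct_smul, dotProduct_smul, hs]
  simp only [smul_eq_mul]
  ring

lemma continuous_mmd_sq (z : Fin N → Z) :
    Continuous fun q => mmd H z q (empirical N) ^ 2 := by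
  simp only [mmd_sq_eq]
  fun_prop

/-- The discrepancy is the norm of an affine function of `q`, hence convex and nonnegative, and
squaring preserves this. -/
lemma convexOn_mmd_sq (z : Fin N → Z) :
    ConvexOn ℝ (simplex N) fun q => mmd H z q (empirical N) ^ 2 := by
  refine ConvexOn.pow ⟨convex_simplex, fun p _ q _ a b ha hb hab => ?_⟩
    (fun q _ => by rw [mmd_eq_norm]; positivity) 2
  have h : a • p + b • q - empirical N = a • (p - empirical N) + b • (q - empirical N) := by
    rw [smul_sub, smul_sub, sub_add_sub_comm, ← add_smul, hab, one_smul]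
  simp only [mmd_eq_norm, smul_eq_mul]
  rw [h, embedding_combo]
  refine (norm_add_le _ _).trans (le_of_eq ?_)
  rw [norm_smul, norm_smul, Real.norm_of_nonneg ha, Real.norm_of_nonneg hb]

lemma mmd_self (z : Fin N → Z) (p : Fin N → ℝ) : mmd H z p p = 0 := by
  simp [mmd_eq_norm, embedding]

lemma mmdModel_objective {Θ : Type*} (ℓ : Θ → Fin N → ℝ) (z : Fin N → Z) (ρ : ℝ) (θ : Θ)
    (lam : ℝ) (q : Fin N → ℝ) :
    expectedLoss ℓ θ q + lam * (ρ - mmd H z q (empirical N) ^ 2) =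
      (mmdModel ℓ (gram H z) ρ).objective θ lam q := by
  simp only [mmdModel, FreeEnergyModel.objective, FreeEnergyModel.energy, Matrix.smul_mulVec,
    dotProduct_smul, smul_eq_mul, dotProduct_sub, dotProduct_neg_potential, mmd_sq_eq,
    gram_transpose]
  ring

end MMD

/-! ### The marginal `χ²`-problem -/

section Marginal

variable {Θ X : Type*} [PseudoMetricSpace X] {N : ℕ} (x : Fin N → X) {L s ρ : ℝ}

/-- For total mass one, the second moment of the density is the χ²-divergence plus one. -/
lemma marginalBall_eq (hN : 0 < N) :
    marginalBall x L s ρ = {q | q ∈ marginalCone x L s ρ ∧ ∑ i, q i = 1} := by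
  have hN' : (0 : ℝ) < N := Nat.cast_pos.2 hN
  have key : ∀ q ∈ simplex N, (chiSqDivergence q (empirical N) ≤ ρ ↔
      1 / (N : ℝ) * ∑ i, ((N : ℝ) * q i) ^ 2 ≤ 1 + ρ) := by
    intro q hq
    have : 1 / (N : ℝ) * ∑ i, ((N : ℝ) * q i) ^ 2 = N * (q ⬝ᵥ q) := by
      simp only [dotProduct, Finset.mul_sum]
      refine Finset.sum_congr rfl fun i _ => ?_
      field_simp
    rw [this, chiSqDivergence_eq hN hq]
    constructor <;> intro h <;> linarith
  ext q
  constructor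
  · rintro ⟨⟨hq, h⟩, hh⟩
    exact ⟨⟨hq.1, (key q hq).1 h, hh⟩, hq.2⟩
  · rintro ⟨⟨h0, h, hh⟩, h1⟩
    exact ⟨⟨⟨h0, h1⟩, (key q ⟨h0, h1⟩).2 h⟩, hh⟩

lemma isClosed_holderDensity : IsClosed {q : Fin N → ℝ | HolderDensity x L s q} := by
  simp only [HolderDensity, Set.ofPred_forall]
  exact isClosed_iInter fun i => isClosed_iInter fun j =>
    isClosed_le (by fun_prop) continuous_const

lemma convex_marginalCone : Convex ℝ (marginalCone x L s ρ) := by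
  rintro p ⟨hp0, hp2, hpH⟩ q ⟨hq0, hq2, hqH⟩ a b ha hb hab
  refine ⟨fun i => ?_, ?_, fun i j => ?_⟩
  · exact add_nonneg (mul_nonneg ha (hp0 i)) (mul_nonneg hb (hq0 i))
  · have hb' : b = 1 - a := by linarith
    have h : ∑ i, ((N : ℝ) * (a • p + b • q) i) ^ 2 ≤
        a * ∑ i, ((N : ℝ) * p i) ^ 2 + b * ∑ i, ((N : ℝ) * q i) ^ 2 := by
      rw [Finset.mul_sum, Finset.mul_sum, ← Finset.sum_add_distrib]
      refine Finset.sum_le_sum fun i _ => ?_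
      simp only [Pi.add_apply, Pi.smul_apply, smul_eq_mul]
      have := mul_nonneg (mul_nonneg ha hb) (sq_nonneg ((N : ℝ) * p i - N * q i))
      subst hb'
      nlinarith
    calc _ ≤ 1 / (N : ℝ) *
        (a * ∑ i, ((N : ℝ) * p i) ^ 2 + b * ∑ i, ((N : ℝ) * q i) ^ 2) :=
          mul_le_mul_of_nonneg_left h (by positivity)
      _ = a * (1 / (N : ℝ) * ∑ i, ((N : ℝ) * p i) ^ 2)
          + b * (1 / (N : ℝ) * ∑ i, ((N : ℝ) * q i) ^ 2) := by ring
      _ ≤ a * (1 + ρ) + b * (1 + ρ) :=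
          add_le_add (mul_le_mul_of_nonneg_left hp2 ha) (mul_le_mul_of_nonneg_left hq2 hb)
      _ = 1 + ρ := by rw [← add_mul, hab, one_mul]
  · have h : (N : ℝ) * (a • p + b • q) i - N * (a • p + b • q) j =
        a * (N * p i - N * p j) + b * (N * q i - N * q j) := by
      simp only [Pi.add_apply, Pi.smul_apply, smul_eq_mul]
      ring
    rw [h]
    calc _ ≤ a * |(N : ℝ) * p i - N * p j| + b * |(N : ℝ) * q i - N * q j| := by
          refine (abs_add_le _ _).trans (le_of_eq ?_)
          rw [abs_mul, abs_mul, abs_of_nonneg ha, abs_of_nonneg hb]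
      _ ≤ a * (L * dist (x i) (x j) ^ s) + b * (L * dist (x i) (x j) ^ s) :=
          add_le_add (mul_le_mul_of_nonneg_left (hpH i j) ha)
            (mul_le_mul_of_nonneg_left (hqH i j) hb)
      _ = _ := by rw [← add_mul, hab, one_mul]

lemma isCompact_marginalBall : IsCompact (marginalBall x L s ρ) := by
  have h : marginalBall x L s ρ = simplex N ∩
      ({q | chiSqDivergence q (empirical N) ≤ ρ} ∩ {q | HolderDensity x L s q}) := by
    ext q
    exact and_assoc
  rw [h]
  exact isCompact_simplex.inter_right
    ((isClosed_le continuous_chiSqDivergence continuous_const).inter (isClosed_holderDensity x))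

/-- Constant densities satisfy the Hölder condition trivially. The values `c = 0, 1, √(1 + ρ)`
supply points of mass below, equal to and above one. -/
lemma const_mem_marginalCone (hN : 0 < N) (hL : 0 ≤ L) {c : ℝ} (hc : 0 ≤ c)
    (hc2 : c ^ 2 ≤ 1 + ρ) : (fun _ => c / N) ∈ marginalCone x L s ρ := by
  have hN' : (0 : ℝ) < N := Nat.cast_pos.2 hN
  refine ⟨fun i => by positivity, ?_, fun i j => ?_⟩
  · rw [Finset.sum_const, Finset.card_univ, Fintype.card_fin,
      nsmul_eq_mul]
    field_simp
    exact hc2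
  · rw [sub_self, abs_zero]
    positivity

lemma sum_const_div (hN : 0 < N) (c : ℝ) : ∑ _i : Fin N, c / N = c := by
  have hN' : (N : ℝ) ≠ 0 := Nat.cast_ne_zero.2 hN.ne'
  rw [Finset.sum_const, Finset.card_univ, Fintype.card_fin, nsmul_eq_mul]
  field_simp

lemma empirical_mem_marginalBall (hN : 0 < N) (hL : 0 ≤ L) (hρ : 0 ≤ ρ) :
    empirical N ∈ marginalBall x L s ρ := by
  rw [marginalBall_eq x hN]
  exact ⟨const_mem_marginalCone x hN hL zero_le_one (by linarith), sum_const_div hN 1⟩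

/-- Dualizing the normalization `∑ q_i = 1` in the marginal `χ²`-problem. -/
lemma marginal_isLeast (hN : 0 < N) (hL : 0 ≤ L) (hρ : 0 < ρ) (ℓ : Θ → Fin N → ℝ) (θ : Θ) :
    IsLeast (Set.range fun η : ℝ => ⨆ q ∈ marginalCone x L s ρ,
        ((η + ∑ i, q i * (ℓ θ i - η) : ℝ) : EReal))
      (worstCase (marginalBall x L s ρ) (expectedLoss ℓ) θ) := by
  obtain ⟨m, hm, hmax⟩ := MaxAttained.of_isCompact (isCompact_marginalBall x)
    ⟨_, empirical_mem_marginalBall x (s := s) hN hL hρ.le⟩ (continuous_expectedLoss ℓ θ)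
  -- The dual objective is the Lagrangian of the normalization constraint, with multiplier `η`.
  have hobj : ∀ (η : ℝ) (q : Fin N → ℝ), η + ∑ i, q i * (ℓ θ i - η) =
      expectedLoss ℓ θ q - η * (∑ i, q i - 1) := by
    intro η q
    simp only [expectedLoss, mul_sub, Finset.sum_sub_distrib, ← Finset.sum_mul]
    ring
  have hle : ∀ η : ℝ, worstCase (marginalBall x L s ρ) (expectedLoss ℓ) θ ≤
      ⨆ q ∈ marginalCone x L s ρ, ((η + ∑ i, q i * (ℓ θ i - η) : ℝ) : EReal) := by
    intro η
    refine iSup₂_le fun q hq => ?_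
    rw [marginalBall_eq x hN] at hq
    refine le_iSup₂_of_le (f := fun q (_ : q ∈ marginalCone x L s ρ) =>
      ((η + ∑ i, q i * (ℓ θ i - η) : ℝ) : EReal)) q hq.1 (EReal.coe_le_coe_iff.2 ?_)
    rw [hobj, hq.2, sub_self, mul_zero, sub_zero]
  have hconv := convex_marginalCone x (L := L) (s := s) (ρ := ρ)
  have haff : ∀ (p q : Fin N → ℝ) (a b : ℝ), a + b = 1 →
      a • (∑ i, p i - 1) + b • (∑ i, q i - 1) = ∑ i, (a • p + b • q) i - 1 := by
    intro p q a b hab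
    simp only [Pi.add_apply, Pi.smul_apply, smul_eq_mul, Finset.sum_add_distrib, ← Finset.mul_sum]
    linear_combination -hab
  obtain ⟨η, hη⟩ := exists_multiplier_of_affine (C := marginalCone x L s ρ)
    (g := fun q => ∑ i, q i - 1) (r := fun q => expectedLoss ℓ θ q - expectedLoss ℓ θ m)
    ⟨hconv, fun p _ q _ a b _ _ hab => (haff p q a b hab).ge⟩
    ⟨hconv, fun p _ q _ a b _ _ hab => (haff p q a b hab).le⟩
    ((concaveOn_expectedLoss ℓ hconv θ).sub (convexOn_const _ hconv))
    (fun q hq h => sub_nonpos.2 (hmax (by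
      rw [marginalBall_eq x hN]
      exact ⟨hq, sub_eq_zero.1 h⟩)))
    -- Masses `0` and `√(1 + ρ)` lie on the two sides of `1`; the second needs `ρ > 0` strictly.
    ⟨_, const_mem_marginalCone x hN hL le_rfl (by linarith), by rw [sum_const_div hN]; norm_num⟩
    ⟨_, const_mem_marginalCone x hN hL (Real.sqrt_nonneg (1 + ρ))
      (Real.sq_sqrt (by linarith)).le, by
        rw [sum_const_div hN, sub_pos, Real.lt_sqrt zero_le_one]
        linarith⟩
  refine ⟨⟨η, le_antisymm (iSup₂_le fun q hq => ?_) (hle η)⟩, ?_⟩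
  · rw [worstCase_eq_of_isMaxOn hm hmax, EReal.coe_le_coe_iff, hobj]
    linarith [hη q hq]
  · rintro _ ⟨η', rfl⟩
    exact hle η'

/-- Mass one distributes `η` over the coordinates, and `(ℓ_i - η)₊ + η = max(ℓ_i, η)`. -/
lemma marginalModel_objective (ℓ : Θ → Fin N → ℝ) (θ : Θ) (η : ℝ) {q : Fin N → ℝ}
    (hq : ∑ i, q i = 1) :
    (marginalModel ℓ x L s ρ).objective θ η q = ∑ i, q i * max (ℓ θ i) η := by
  have h : ∑ i, q i * max (ℓ θ i) η = ∑ i, (q i * max (ℓ θ i - η) 0 + q i * η) :=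
    Finset.sum_congr rfl fun i _ => by
      rw [← mul_add, ← max_add_add_right, sub_add_cancel, zero_add]
  rw [h, Finset.sum_add_distrib, ← Finset.sum_mul, hq]
  simp only [FreeEnergyModel.objective, FreeEnergyModel.energy, marginalModel,
    Matrix.zero_mulVec, dotProduct_zero]
  simp only [dotProduct, mul_neg, Finset.sum_neg_distrib]
  ring

lemma marginal_equivFreeEnergy (hN : 0 < N) (hL : 0 ≤ L) (hρ : 0 ≤ ρ) (ℓ : Θ → Fin N → ℝ)
    (hℓ : ∀ θ i, 0 ≤ ℓ θ i) :
    EquivFreeEnergy (marginalBall x L s ρ) (expectedLoss ℓ) (marginalModel ℓ x L s ρ) := by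
  refine .of_isLeast (fun θ => ?_) (fun θ => ⟨⟨0, Set.self_mem_Ici, ?_⟩, ?_⟩)
  · have hne : (marginalBall x L s ρ).Nonempty := ⟨_, empirical_mem_marginalBall x hN hL hρ⟩
    obtain ⟨m, -, hmax⟩ := MaxAttained.of_isCompact (isCompact_marginalBall x) hne
      (continuous_expectedLoss ℓ θ)
    exact worstCase_ne_bot_and_ne_top hne fun q hq => hmax hq
  · refine iSup_congr fun q => iSup_congr fun hq => ?_
    rw [marginalModel_objective x ℓ θ 0 hq.1.1.2]
    -- Nonnegativity of the losses makes the truncation at `η = 0` inactive.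
    simp only [max_eq_left (hℓ θ _), expectedLoss]
  · rintro _ ⟨η, -, rfl⟩
    refine iSup₂_mono fun q hq => EReal.coe_le_coe_iff.2 ?_
    rw [marginalModel_objective x ℓ θ η hq.1.1.2]
    exact Finset.sum_le_sum fun i _ =>
      mul_le_mul_of_nonneg_left (le_max_left _ _) (hq.1.1.1 i)

end Marginal

/-! ### The geometric methods -/

section Geometric

variable {Θ : Type*} {N : ℕ} (G : WeightedGraph N) (ξ : Interpolation)

lemma isTransport_const {p : Fin N → ℝ} (hp : p ∈ openSimplex N) :
    IsTransport G ξ p p (fun _ => p) (fun _ _ _ => 0) where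
  mem _ _ := hp
  antisymm _ _ _ _ _ := by simp
  measurable _ _ := measurable_const
  continuity t _ := by
    have h : -divergence G ξ p (fun _ _ => 0) = 0 := by
      ext i
      simp [divergence]
    rw [h]
    exact hasDerivWithinAt_const t _ p
  start := rfl
  finish := rfl

lemma gwSq_self {p : Fin N → ℝ} (hp : p ∈ openSimplex N) : gwSq G ξ p p = 0 := by
  refine le_antisymm ?_ zero_le
  refine (iInf₂_le (fun _ => p) (fun _ _ _ => 0)).trans
    ((iInf_le _ (isTransport_const G ξ hp)).trans (le_of_eq ?_))
  simp [WeightedGraph.edgeSum]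

lemma empirical_mem_gwBall (hN : 0 < N) (ρ : ℝ) : empirical N ∈ gwBall G ξ ρ := by
  refine ⟨empirical_mem_openSimplex hN, ?_⟩
  rw [gwSq_self G ξ (empirical_mem_openSimplex hN)]
  exact zero_le

/-- The bound comes from the compact simplex containing the ball, so compactness of the ball itself
is not needed. -/
lemma exists_le_of_continuous {f : (Fin N → ℝ) → ℝ} (hf : Continuous f) (ρ : ℝ) :
    ∃ M, ∀ q ∈ gwBall G ξ ρ, f q ≤ M := by
  obtain ⟨M, hM⟩ := isCompact_simplex.bddAbove_image hf.continuousOn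
  exact ⟨M, fun q hq => hM ⟨q, openSimplex_subset_simplex hq.1, rfl⟩⟩

lemma sum_mul_log_eq_neg_entropy (q : Fin N → ℝ) : ∑ i, q i * Real.log (q i) = -entropy q := by
  simp [entropy, Real.negMulLog, Finset.sum_neg_distrib]

lemma gdroRisk_eq_neg_energy (ℓ : Θ → Fin N → ℝ) (β ρ : ℝ) (θ : Θ) (lam : ℝ)
    (q : Fin N → ℝ) :
    gdroRisk ℓ β θ q = -(gdroModel ℓ G ξ β ρ).energy q θ lam := by
  have h : ∑ i, q i * ℓ θ i = expectedLoss ℓ θ q := rfl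
  simp only [gdroRisk, h, FreeEnergyModel.energy, gdroModel, Matrix.zero_mulVec,
    dotProduct_zero, dotProduct_neg_potential, sum_mul_log_eq_neg_entropy]
  ring

lemma gcdroRisk_eq_neg_energy (ℓ : Θ → Fin N → ℝ) (α β ρ : ℝ) (θ : Θ) (lam : ℝ)
    (q : Fin N → ℝ) :
    gcdroRisk ℓ G α β θ q = -(gcdroModel ℓ G ξ α β ρ).energy q θ lam := by
  have h : ∑ i, q i * ℓ θ i = expectedLoss ℓ θ q := rfl
  -- `edgeSum` runs over ordered pairs, as the quadratic form does, so the coefficient `α / 2`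
  -- carries over unchanged.
  have hK : q ⬝ᵥ ((gcdroModel ℓ G ξ α β ρ).interaction θ lam *ᵥ q) =
      α / 2 * G.edgeSum (fun i j => G.weight i j * q i * q j * (ℓ θ i - ℓ θ j) ^ 2) := by
    simp only [gcdroModel, dotProduct, Matrix.mulVec, Matrix.of_apply, WeightedGraph.edgeSum,
      Finset.mul_sum]
    refine Finset.sum_congr rfl fun i _ => Finset.sum_congr rfl fun j _ => ?_
    split_ifs <;> ring
  rw [FreeEnergyModel.energy, hK]
  simp only [gcdroRisk, h, gcdroModel, dotProduct_neg_potential, sum_mul_log_eq_neg_entropy]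
  ring

lemma continuous_energy (F : FreeEnergyModel Θ N) (θ : Θ) (lam : ℝ) :
    Continuous fun q => F.energy q θ lam := by
  have := continuous_entropy (N := N)
  unfold FreeEnergyModel.energy
  fun_prop

/-- A model on the geometric Wasserstein set whose free energy is `-R` is equivalent to the
problem with risk `R`. -/
lemma EquivFreeEnergy.of_gwBall (hN : 0 < N) {ρ : ℝ} {R : Θ → (Fin N → ℝ) → ℝ}
    {F : FreeEnergyModel Θ N} (hP : F.feasible = gwBall G ξ ρ) (hρ : 0 ≤ F.radius)
    (hR : ∀ θ lam q, R θ q = -F.energy q θ lam) :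
    EquivFreeEnergy (gwBall G ξ ρ) R F := by
  rw [← hP]
  refine .of_objective_eq ?_ hρ (fun θ => ?_) (fun θ lam q => ?_)
  · rw [hP]
    exact ⟨_, empirical_mem_gwBall G ξ hN ρ⟩
  · simp only [hR _ 0, hP]
    exact exists_le_of_continuous G ξ (continuous_energy F θ 0).neg ρ
  · rw [hR θ lam q]
    rfl

end Geometric

end DRO

theorem proposition3p1 {Θ X Y H : Type*} [PseudoMetricSpace X]
    [NormedAddCommGroup H] [InnerProductSpace ℝ H] [CompleteSpace H] [RKHS ℝ H (X × Y) ℝ]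
    {N : ℕ} (hN : 0 < N)
    (f : Θ → X → Y) (loss : Y → Y → ℝ) (x : Fin N → X) (y : Fin N → Y)
    (ℓ : Θ → Fin N → ℝ) (hℓ : ℓ = DRO.sampleLoss f loss x y)
    (z : Fin N → X × Y) (hz : z = fun i => (x i, y i))
    (G : DRO.WeightedGraph N) (ξ : DRO.Interpolation)
    (ρ : ℝ) (hρ : 0 < ρ) (α β : ℝ) (L s : ℝ) (hL : 0 ≤ L) (hs : 0 < s) :
    -- KL-DRO
    ((∀ θ lam, 0 ≤ lam → ∀ q ∈ DRO.simplex N,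
        DRO.expectedLoss ℓ θ q + lam * (ρ - DRO.klDivergence q (DRO.empirical N)) =
          (DRO.klModel ℓ ρ).objective θ lam q) ∧
      DRO.EquivFreeEnergy (DRO.klBall N ρ) (DRO.expectedLoss ℓ) (DRO.klModel ℓ ρ) ∧
      (∀ θ, DRO.MaxAttained (DRO.klBall N ρ) (DRO.expectedLoss ℓ θ)) ∧
      (∀ θ lam, 0 ≤ lam →
        DRO.MaxAttained (DRO.simplex N) ((DRO.klModel ℓ ρ).objective θ lam))) ∧
    -- χ²-DRO (the multiplier is rescaled by the factor `N`)
    ((∀ θ lam, 0 ≤ lam → ∀ q ∈ DRO.simplex N,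
        DRO.expectedLoss ℓ θ q + lam * (ρ - DRO.chiSqDivergence q (DRO.empirical N)) =
          (DRO.chiSqModel ℓ ρ).objective θ (N * lam) q) ∧
      DRO.EquivFreeEnergy (DRO.chiSqBall N ρ) (DRO.expectedLoss ℓ) (DRO.chiSqModel ℓ ρ) ∧
      (∀ θ, DRO.MaxAttained (DRO.chiSqBall N ρ) (DRO.expectedLoss ℓ θ)) ∧
      (∀ θ lam, 0 ≤ lam →
        DRO.MaxAttained (DRO.simplex N) ((DRO.chiSqModel ℓ ρ).objective θ lam))) ∧
    -- MMD-DRO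
    ((∀ θ lam, 0 ≤ lam → ∀ q ∈ DRO.simplex N,
        DRO.expectedLoss ℓ θ q + lam * (ρ - DRO.mmd H z q (DRO.empirical N) ^ 2) =
          (DRO.mmdModel ℓ (DRO.gram H z) ρ).objective θ lam q) ∧
      DRO.EquivFreeEnergy (DRO.mmdBall H z ρ) (DRO.expectedLoss ℓ)
        (DRO.mmdModel ℓ (DRO.gram H z) ρ) ∧
      (∀ θ, DRO.MaxAttained (DRO.mmdBall H z ρ) (DRO.expectedLoss ℓ θ)) ∧
      (∀ θ lam, 0 ≤ lam →
        DRO.MaxAttained (DRO.simplex N)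
          ((DRO.mmdModel ℓ (DRO.gram H z) ρ).objective θ lam))) ∧
    -- marginal χ²-DRO; first the dual form in which the normalization is dualized
    ((∀ θ, IsLeast
        (Set.range fun η : ℝ => ⨆ q ∈ DRO.marginalCone x L s ρ,
          ((η + ∑ i, q i * (ℓ θ i - η) : ℝ) : EReal))
        (DRO.worstCase (DRO.marginalBall x L s ρ) (DRO.expectedLoss ℓ) θ)) ∧
      ((∀ a b, 0 ≤ loss a b) →
        DRO.EquivFreeEnergy (DRO.marginalBall x L s ρ) (DRO.expectedLoss ℓ)
          (DRO.marginalModel ℓ x L s ρ)) ∧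
      (∀ θ, DRO.MaxAttained (DRO.marginalBall x L s ρ) (DRO.expectedLoss ℓ θ)) ∧
      (∀ θ η, 0 ≤ η →
        DRO.MaxAttained (DRO.marginalBall x L s ρ)
          ((DRO.marginalModel ℓ x L s ρ).objective θ η))) ∧
    -- GDRO
    DRO.EquivFreeEnergy (DRO.gwBall G ξ ρ) (DRO.gdroRisk ℓ β) (DRO.gdroModel ℓ G ξ β ρ) ∧
    -- GCDRO
    ((∀ θ lam q, DRO.gcdroRisk ℓ G α β θ q = -(DRO.gcdroModel ℓ G ξ α β ρ).energy q θ lam) ∧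
      DRO.EquivFreeEnergy (DRO.gwBall G ξ ρ) (DRO.gcdroRisk ℓ G α β)
        (DRO.gcdroModel ℓ G ξ α β ρ)) := by
  have hcompact : ∀ {D : (Fin N → ℝ) → ℝ}, Continuous D →
      IsCompact {q | q ∈ DRO.simplex N ∧ D q ≤ ρ} := fun hD =>
    DRO.isCompact_simplex.inter_right (isClosed_le hD continuous_const)
  have hsimplex : ∀ (F : DRO.FreeEnergyModel Θ N) θ lam,
      DRO.MaxAttained (DRO.simplex N) (F.objective θ lam) := fun F θ lam =>
    .of_isCompact DRO.isCompact_simplex ⟨_, DRO.empirical_mem_simplex hN⟩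
      (DRO.continuous_objective F θ lam)
  have hemp := DRO.empirical_mem_simplex hN
  have hkl : DRO.klDivergence (DRO.empirical N) (DRO.empirical N) < ρ := by
    rwa [DRO.klDivergence_empirical_self hN]
  have hchi : DRO.chiSqDivergence (DRO.empirical N) (DRO.empirical N) < ρ := by
    rwa [DRO.chiSqDivergence_empirical_self hN]
  have hmmd : DRO.mmd H z (DRO.empirical N) (DRO.empirical N) ^ 2 < ρ := by
    rwa [DRO.mmd_self, zero_pow two_ne_zero]
  have hklmax : ∀ θ, DRO.MaxAttained (DRO.klBall N ρ) (DRO.expectedLoss ℓ θ) := fun θ =>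
    .of_isCompact (hcompact DRO.continuous_klDivergence) ⟨_, hemp, hkl.le⟩
      (DRO.continuous_expectedLoss ℓ θ)
  have hchimax : ∀ θ, DRO.MaxAttained (DRO.chiSqBall N ρ) (DRO.expectedLoss ℓ θ) := fun θ =>
    .of_isCompact (hcompact DRO.continuous_chiSqDivergence) ⟨_, hemp, hchi.le⟩
      (DRO.continuous_expectedLoss ℓ θ)
  have hmmdmax : ∀ θ, DRO.MaxAttained (DRO.mmdBall H z ρ) (DRO.expectedLoss ℓ θ) := fun θ =>
    .of_isCompact (hcompact (DRO.continuous_mmd_sq z)) ⟨_, hemp, hmmd.le⟩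
      (DRO.continuous_expectedLoss ℓ θ)
  have hmarg : (DRO.marginalBall x L s ρ).Nonempty :=
    ⟨_, DRO.empirical_mem_marginalBall x hN hL hρ.le⟩
  refine ⟨⟨fun θ lam _ q hq => DRO.klModel_objective ℓ hN ρ θ lam hq, ?_, hklmax,
      fun θ lam _ => hsimplex _ θ lam⟩,
    ⟨fun θ lam _ q hq => DRO.chiSqModel_objective ℓ hN ρ θ lam hq, ?_, hchimax,
      fun θ lam _ => hsimplex _ θ lam⟩,
    ⟨fun θ lam _ q _ => DRO.mmdModel_objective ℓ z ρ θ lam q, ?_, hmmdmax,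
      fun θ lam _ => hsimplex _ θ lam⟩,
    ⟨DRO.marginal_isLeast x hN hL hρ ℓ, fun hloss => ?_, fun θ => ?_, fun θ η _ => ?_⟩,
    ?_, DRO.gcdroRisk_eq_neg_energy G ξ ℓ α β ρ, ?_⟩
  · refine .of_lagrangian one_pos rfl (fun θ lam _ q hq => ?_) DRO.convexOn_klDivergence
      (DRO.concaveOn_expectedLoss ℓ DRO.convex_simplex) ⟨_, hemp, hkl⟩ hklmax
    rw [one_mul]
    exact DRO.klModel_objective ℓ hN ρ θ lam hq
  -- Here the rescaling constant `c` is `N`; for KL and MMD it is `1`.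
  · exact .of_lagrangian (Nat.cast_pos.2 hN) rfl
      (fun θ lam _ q hq => DRO.chiSqModel_objective ℓ hN ρ θ lam hq) DRO.convexOn_chiSqDivergence
      (DRO.concaveOn_expectedLoss ℓ DRO.convex_simplex) ⟨_, hemp, hchi⟩ hchimax
  · refine .of_lagrangian one_pos rfl (fun θ lam _ q _ => ?_) (DRO.convexOn_mmd_sq z)
      (DRO.concaveOn_expectedLoss ℓ DRO.convex_simplex) ⟨_, hemp, hmmd⟩ hmmdmax
    rw [one_mul]
    exact DRO.mmdModel_objective ℓ z ρ θ lam q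
  · exact DRO.marginal_equivFreeEnergy x hN hL hρ.le ℓ fun θ i => by
      rw [hℓ]
      exact hloss _ _
  · exact .of_isCompact (DRO.isCompact_marginalBall x) hmarg (DRO.continuous_expectedLoss ℓ θ)
  · exact .of_isCompact (DRO.isCompact_marginalBall x) hmarg (DRO.continuous_objective _ θ η)
  · exact .of_gwBall G ξ hN rfl hρ.le (DRO.gdroRisk_eq_neg_energy G ξ ℓ β ρ)
  · exact .of_gwBall G ξ hN rfl hρ.le (DRO.gcdroRisk_eq_neg_energy G ξ ℓ α β ρ)
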